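/- Let $n\ge 1$ and let $B\in\mathbb{R}^{n\times n}$ be a matrix whose $n^2$ entries $B_{ij}$ are algebraically independent over $\mathbb{Q}$, that is, $f((B_{ij}))\neq 0$ for every non-zero polynomial $f$ in $n^2$ indeterminates with rational coefficients. Let $L=B^{T}B$ and let $P_L$ be the L-ensemble with kernel $L$, that is, the probability distribution of $n$ binary random variables $X_1,\dots,X_n$ with $P_L(X=x)=\det(L_x)/\det(L+I)$ for $x\in\{0,1\}^n$, where $L_x=[L_{ij}]_{x_i=1,\,x_j=1}$ and $\det(L_x)=1$ for $x=0$. (a) Every probabilistic sentential decision diagram (PSDD) over $X_1,\dots,X_n$ that computes $P_L$ has size (number of nodes) at least $2^{n-1}$. (b) For every $q\in\{1,\dots,n\}$, all events $(X_j)_{j\ne q}=x$ with $x\in\{0,1\}^{n-1}$ have positive probability under $P_L$, and the $2^{n-1}$ conditional probabilities $P_L(X_q=1\mid (X_j)_{j\neq q}=x)$ are pairwise distinct. Here a PSDD consists of a vtree (an ordered full binary tree whose leaves are in bijection with the variables) and a finite rooted directed acyclic graph whose root is not $\bot$ and is normalized for the root of the vtree. A node normalized for a vtree leaf with variable $X$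 is one of $X$, $\overline{X}$, $\bot$, or $\top$ with a parameter $0<\theta<1$. A node normalized for an inner vtree node is $\bot$ or a decision node with elements $(p_1,s_1),\dots,(p_k,s_k)$ and parameters $\theta_1,\dots,\theta_k\ge 0$, where the primes $p_j$ are normalized for the left child and the subs $s_j$ for the right child of the vtree node, the primes are consistent, mutually exclusive and exhaustive as propositional sentences (a decision node stands for $\bigvee_j p_j\wedge s_j$), $\sum_j\theta_j=1$, and $\theta_j=0$ if and only if $s_j=\bot$. On an assignment $x$, a literal evaluates to $1$ or $0$ according to whether $x$ satisfies it, $\bot$ to $0$, $\top$ with parameter $\theta$ to $\theta$ or $1-\theta$ according to whether its variable is $1$ or $0$, and a decision node to $\sum_j\theta_j\,p_j(x)\,s_j(x)$. The PSDD computes a distribution if that distribution is proportional to the evaluation of its root. -/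

import Mathlib

/-- The probability that the L-ensemble with kernel `L` gives to the assignment `x` of the binary
variables `X_0, …, X_{n-1}`: the principal minor `det (L_x)` indexed by the `i` with `x i = 1`,
divided by the normalizing constant `det (L + I)`. -/
noncomputable def lEnsemble {n : ℕ} (L : Matrix (Fin n) (Fin n) ℝ) (x : Fin n → Bool) : ℝ :=
  (L.submatrix (fun i : {i : Fin n // x i = true} => (i : Fin n))
      (fun i : {i : Fin n // x i = true} => (i : Fin n))).det / (L + 1).det

/-- The full assignment that gives the value `b` to the variable `q` and agrees with `x` on the
other variables. -/
def extendAssignment {n : ℕ} (q : Fin n) (x : {j : Fin n // j ≠ q} → Bool) (b : Bool) :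
    Fin n → Bool :=
  fun j => if h : j = q then b else x ⟨j, h⟩

/-- The marginal probability `Pr((X_j)_{j ≠ q} = x)` under the distribution `p`. -/
def restProb {n : ℕ} (p : (Fin n → Bool) → ℝ) (q : Fin n) (x : {j : Fin n // j ≠ q} → Bool) : ℝ :=
  p (extendAssignment q x true) + p (extendAssignment q x false)

/-- The conditional probability `Pr(X_q = 1 | (X_j)_{j ≠ q} = x)` under the distribution `p`
(meaningful when `restProb p q x` is positive). -/
noncomputable def condProb {n : ℕ} (p : (Fin n → Bool) → ℝ) (q : Fin n)
    (x : {j : Fin n // j ≠ q} → Bool) : ℝ :=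
  p (extendAssignment q x true) / restProb p q x

/-- Full binary trees, with ordered children, whose leaves are labelled by variables. -/
inductive VTree (n : ℕ) : Type where
  | leaf (x : Fin n) : VTree n
  | node (l r : VTree n) : VTree n

/-- The variables at the leaves, from left to right. -/
def VTree.vars {n : ℕ} : VTree n → List (Fin n)
  | .leaf x => [x]
  | .node l r => l.vars ++ r.vars

/-- The content of a node of a probabilistic sentential decision diagram over `n` variables, where
`ι` is the type of the nodes:
* a literal, `X_x` (for `b = true`) or its negation (for `b = false`);
* `⊤` over the variable `X_x`, with a parameter `θ`;
* `⊥`;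
* a decision node with elements `(prime j, sub j)` and parameters `θ j`, for `j < k`. -/
inductive PSDDNode (n : ℕ) (ι : Type) : Type where
  | lit (x : Fin n) (b : Bool) : PSDDNode n ι
  | top (x : Fin n) (θ : ℝ) : PSDDNode n ι
  | bot : PSDDNode n ι
  | decision (k : ℕ) (prime sub : Fin k → ι) (θ : Fin k → ℝ) : PSDDNode n ι

namespace PSDDNode

variable {n : ℕ} {ι : Type}

/-- `Models nd v i a`: the assignment `a` satisfies the propositional sentence that is represented
by the node `i`, read at the vtree node `v` (the base of the node). A decision node represents the
disjunction over its elements of the conjunctions of prime and sub. -/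
def Models (nd : ι → PSDDNode n ι) : VTree n → ι → (Fin n → Bool) → Prop
  | .leaf _, i, a =>
    match nd i with
    | .lit y b => a y = b
    | .top _ _ => True
    | .bot => False
    | .decision _ _ _ _ => False
  | .node l r, i, a =>
    match nd i with
    | .decision _ p s _ => ∃ j, Models nd l (p j) a ∧ Models nd r (s j) a
    | .lit _ _ => False
    | .top _ _ => False
    | .bot => False

/-- `IsNormalizedFor nd v i`: the node `i`, with all nodes below it, is a syntactically correct
PSDD node that is normalized for the vtree node `v`.
* At a leaf with variable `x` the node is a literal of `x`, or `⊤` over `x` with `0 < θ < 1`,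
  or `⊥`.
* At an inner vtree node with children `l` and `r` it is `⊥`, or a decision node whose primes are
  normalized for `l` and whose subs are normalized for `r`, whose primes are consistent, mutually
  exclusive and exhaustive, and whose parameters are nonnegative, sum to one, and vanish exactly
  for the elements with sub `⊥`. -/
def IsNormalizedFor (nd : ι → PSDDNode n ι) : VTree n → ι → Prop
  | .leaf x, i =>
    match nd i with
    | .lit y _ => y = x
    | .top y θ => y = x ∧ 0 < θ ∧ θ < 1
    | .bot => True
    | .decision _ _ _ _ => False
  | .node l r, i =>
    match nd i with
    | .decision _ p s θ =>
      (∀ j, IsNormalizedFor nd l (p j)) ∧ (∀ j, IsNormalizedFor nd r (s j)) ∧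
      (∀ j, ∃ a, Models nd l (p j) a) ∧ (∀ a, ∃! j, Models nd l (p j) a) ∧
      (∀ j, 0 ≤ θ j) ∧ (∑ j, θ j = 1) ∧ (∀ j, θ j = 0 ↔ nd (s j) = .bot)
    | .bot => True
    | .lit _ _ => False
    | .top _ _ => False

/-- The value of the node `i`, read at the vtree node `v`, on the assignment `a`, which is the
probability of `a` under the distribution of the node. For a decision node this is the evaluation
of a sum node whose children are the products of prime and sub; since a node vanishes on the
assignments that do not satisfy its base, only the element whose prime is satisfied by `a`
contributes. -/
noncomputable def eval (nd : ι → PSDDNode n ι) : VTree n → ι → (Fin n → Bool) → ℝ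
  | .leaf _, i, a =>
    match nd i with
    | .lit y b => if a y = b then 1 else 0
    | .top y θ => if a y = true then θ else 1 - θ
    | .bot => 0
    | .decision _ _ _ _ => 0
  | .node l r, i, a =>
    match nd i with
    | .decision _ p s θ => ∑ j, θ j * (eval nd l (p j) a * eval nd r (s j) a)
    | .lit _ _ => 0
    | .top _ _ => 0
    | .bot => 0

end PSDDNode

/-- A probabilistic sentential decision diagram (PSDD) over `n` binary variables: a vtree whose
leaves are in bijection with the variables, and a directed graph of `size` nodes with a root that
is normalized for the vtree and is not `⊥`. Nodes may be shared by several parents. The children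
of a decision node are normalized for the children of its vtree node, so that the diagram below the
root is acyclic. -/
structure PSDD (n : ℕ) where
  /-- the vtree -/
  vtree : VTree n
  /-- no variable occurs at two leaves -/
  nodup_vars : vtree.vars.Nodup
  /-- every variable occurs at a leaf -/
  mem_vars : ∀ x, x ∈ vtree.vars
  /-- the number of nodes -/
  size : ℕ
  /-- the content of each node -/
  nodes : Fin size → PSDDNode n (Fin size)
  /-- the root -/
  root : Fin size
  /-- the root, and hence everything below it, obeys the syntax -/
  normalized : PSDDNode.IsNormalizedFor nodes vtree root
  /-- the root is not `⊥` -/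
  root_ne_bot : nodes root ≠ .bot

/-- The value of a PSDD on an assignment of the variables. -/
noncomputable def PSDD.eval {n : ℕ} (P : PSDD n) (a : Fin n → Bool) : ℝ :=
  PSDDNode.eval P.nodes P.vtree P.root a

/-- The PSDD `P` computes the distribution `p`: `p` is proportional to the evaluation of `P`. (As
the values of a PSDD sum to one, the constant is one when `p` does so, too.) -/
def PSDD.Computes {n : ℕ} (P : PSDD n) (p : (Fin n → Bool) → ℝ) : Prop :=
  ∃ c : ℝ, c ≠ 0 ∧ ∀ a, p a = c * P.eval a

/-!
The proof rests on the conditional probabilities of part (b), from which part (a) follows.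

*Conditional probabilities.* Write `G B x` for the principal minor of `Bᵀ * B` at the support of
`x`. As `det B ≠ 0`, the matrix `Bᵀ * B` is positive definite, so all these minors are positive.
If two conditional probabilities of `X_q` agree, given `x` and given `y`, then
`G B x₁ * G B y₀ = G B y₁ * G B x₀`, where the index is the value of `X_q`. This is a polynomial
identity with rational coefficients in the entries of `B`, so by algebraic independence it holds
for every rational matrix (`gramMinor_mul_eq_mul_of_algebraicIndependent`). If, say, `x i = 1` and
`y i = 0`, it fails for the identity matrix with its column `q` replaced by the unit vector `e_i`:
then `G x₁ = 0` because of two equal columns, while the other minors are minors of the identity.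

*Size of a PSDD.* Let `q` be the variable at the rightmost leaf of the vtree and fix the other
variables. At each decision node on the way down the right spine the primes do not mention `q`, and
exactly one of them is satisfied, so the evaluation is a constant times the evaluation of one sub.
At the end there is a node `⊤` for `q`, whose parameter has to be the conditional probability of
`X_q = 1` (`PSDDNode.exists_top_of_eval_ne_zero`). Distinct conditional probabilities require
distinct nodes, and there are `2 ^ (n - 1)` of them.
-/

/-! ### Principal minors of Gram matrices -/

/-- The principal minor of the Gram matrix `Mᵀ * M` of the columns of `M` that is indexed by the
`i` with `x i = true`. It is defined over any commutative ring, so that it can be compared along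
ring homomorphisms. -/
def gramMinor {n : ℕ} {R : Type*} [CommRing R] (M : Matrix (Fin n) (Fin n) R)
    (x : Fin n → Bool) : R :=
  ((M.transpose * M).submatrix (fun i : {i : Fin n // x i = true} => (i : Fin n))
      (fun i : {i : Fin n // x i = true} => (i : Fin n))).det

theorem lEnsemble_eq_gramMinor_div {n : ℕ} (B : Matrix (Fin n) (Fin n) ℝ) (x : Fin n → Bool) :
    lEnsemble (B.transpose * B) x = gramMinor B x / (B.transpose * B + 1).det :=
  rfl

theorem map_gramMinor {n : ℕ} {R S : Type*} [CommRing R] [CommRing S] (f : R →+* S)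
    (M : Matrix (Fin n) (Fin n) R) (x : Fin n → Bool) :
    f (gramMinor M x) = gramMinor (M.map f) x := by
  unfold gramMinor
  rw [RingHom.map_det]
  congr 1
  ext i j
  simp [Matrix.mul_apply]

theorem gramMinor_pos {n : ℕ} {B : Matrix (Fin n) (Fin n) ℝ} (hB : B.det ≠ 0)
    (x : Fin n → Bool) : 0 < gramMinor B x := by
  have hinj : Function.Injective B.mulVec :=
    Matrix.mulVec_injective_iff_isUnit.2 ((Matrix.isUnit_iff_isUnit_det B).2 hB.isUnit)
  have h := Matrix.PosDef.conjTranspose_mul_self B hinj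
  rw [Matrix.conjTranspose_eq_transpose_of_trivial] at h
  exact (h.submatrix Subtype.val_injective).det_pos

theorem det_transpose_mul_self_add_one_pos {n : ℕ} (B : Matrix (Fin n) (Fin n) ℝ) :
    0 < (B.transpose * B + 1).det := by
  have h := Matrix.posSemidef_conjTranspose_mul_self B
  rw [Matrix.conjTranspose_eq_transpose_of_trivial] at h
  exact (Matrix.PosDef.posSemidef_add h Matrix.PosDef.one).det_pos

/-- The Gram matrix of the unit vectors `e_(φ c)` has entries `δ_(φ r, φ c)`; its principal minor
is `1` when `φ` is injective on the index set. -/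
theorem gramMinor_one_submatrix_of_injOn {n : ℕ} {φ : Fin n → Fin n} {x : Fin n → Bool}
    (h : Set.InjOn φ {i | x i = true}) :
    gramMinor ((1 : Matrix (Fin n) (Fin n) ℚ).submatrix id φ) x = 1 := by
  unfold gramMinor
  rw [Matrix.transpose_submatrix, ← Matrix.submatrix_mul _ _ _ _ _ Function.bijective_id,
    Matrix.transpose_one, Matrix.one_mul, Matrix.submatrix_submatrix,
    Matrix.submatrix_one (φ ∘ fun i : {i : Fin n // x i = true} => (i : Fin n))
      (fun a b hab => Subtype.ext (h a.2 b.2 hab)), Matrix.det_one]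

theorem gramMinor_one_submatrix_of_eq {n : ℕ} {φ : Fin n → Fin n} {x : Fin n → Bool}
    {i j : Fin n} (hij : i ≠ j) (hi : x i = true) (hj : x j = true) (h : φ i = φ j) :
    gramMinor ((1 : Matrix (Fin n) (Fin n) ℚ).submatrix id φ) x = 0 := by
  unfold gramMinor
  refine Matrix.det_zero_of_row_eq (i := ⟨i, hi⟩) (j := ⟨j, hj⟩) (by simpa using hij) ?_
  ext c
  simp only [Matrix.submatrix_apply, Matrix.mul_apply, Matrix.transpose_apply]
  rw [h]

/-! ### Matrices with algebraically independent entries -/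

theorem det_ne_zero_of_algebraicIndependent {n : ℕ} {B : Matrix (Fin n) (Fin n) ℝ}
    (hB : AlgebraicIndependent ℚ (fun ij : Fin n × Fin n => B ij.1 ij.2)) : B.det ≠ 0 := by
  intro h
  refine Matrix.det_mvPolynomialX_ne_zero (Fin n) ℚ
    (algebraicIndependent_iff.1 hB _ ?_)
  rw [AlgHom.map_det, Matrix.mvPolynomialX_mapMatrix_aeval, h]

/-- An equation between products of principal Gram minors that holds for a matrix with
algebraically independent entries is a polynomial identity. -/
theorem gramMinor_mul_eq_mul_of_algebraicIndependent {n : ℕ} {B : Matrix (Fin n) (Fin n) ℝ}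
    (hB : AlgebraicIndependent ℚ (fun ij : Fin n × Fin n => B ij.1 ij.2))
    {x y z w : Fin n → Bool}
    (h : gramMinor B x * gramMinor B y = gramMinor B z * gramMinor B w)
    (M : Matrix (Fin n) (Fin n) ℚ) :
    gramMinor M x * gramMinor M y = gramMinor M z * gramMinor M w := by
  have key : ∀ {R : Type} [CommRing R] [Algebra ℚ R] (A : Matrix (Fin n) (Fin n) R)
      (u : Fin n → Bool),
      MvPolynomial.aeval (fun ij : Fin n × Fin n => A ij.1 ij.2)
        (gramMinor (Matrix.mvPolynomialX (Fin n) (Fin n) ℚ) u) = gramMinor A u := by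
    intro R _ _ A u
    refine (map_gramMinor (MvPolynomial.aeval (R := ℚ)
      (fun ij : Fin n × Fin n => A ij.1 ij.2)).toRingHom _ u).trans ?_
    congr 1
    ext i j
    simp
  have hX : gramMinor (Matrix.mvPolynomialX (Fin n) (Fin n) ℚ) x *
      gramMinor (Matrix.mvPolynomialX (Fin n) (Fin n) ℚ) y =
      gramMinor (Matrix.mvPolynomialX (Fin n) (Fin n) ℚ) z *
      gramMinor (Matrix.mvPolynomialX (Fin n) (Fin n) ℚ) w := by
    apply hB
    simpa only [map_mul, key] using h
  simpa only [map_mul, key] using congrArg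
    (MvPolynomial.aeval (R := ℚ) (fun ij : Fin n × Fin n => M ij.1 ij.2)) hX

/-! ### Conditional probabilities of the L-ensemble -/

@[simp]
theorem extendAssignment_self {n : ℕ} (q : Fin n) (x : {j : Fin n // j ≠ q} → Bool) (b : Bool) :
    extendAssignment q x b q = b := by
  simp [extendAssignment]

theorem extendAssignment_of_ne {n : ℕ} {q j : Fin n} (h : j ≠ q)
    (x : {j : Fin n // j ≠ q} → Bool) (b : Bool) :
    extendAssignment q x b j = x ⟨j, h⟩ := by
  simp [extendAssignment, h]

theorem gramMinor_extendAssignment_mul_ne {n : ℕ} {B : Matrix (Fin n) (Fin n) ℝ}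
    (hB : AlgebraicIndependent ℚ (fun ij : Fin n × Fin n => B ij.1 ij.2)) {q : Fin n}
    {x y : {j : Fin n // j ≠ q} → Bool} {i : {j : Fin n // j ≠ q}}
    (hx : x i = true) (hy : y i = false) :
    gramMinor B (extendAssignment q x true) * gramMinor B (extendAssignment q y false) ≠
      gramMinor B (extendAssignment q y true) * gramMinor B (extendAssignment q x false) := by
  intro h
  obtain ⟨i, hi⟩ := i
  let φ : Fin n → Fin n := fun c => if c = q then i else c
  -- Columns that include `q` but not `i`, or do not include `q`, are distinct unit vectors.
  have hφ : ∀ u : Fin n → Bool, (u q = true → u i = false) →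
      Set.InjOn φ {j | u j = true} := by
    intro u hu a ha b hb hab
    simp only [Set.mem_ofPred_eq] at ha hb
    simp only [φ] at hab
    split_ifs at hab <;> grind
  have h' := gramMinor_mul_eq_mul_of_algebraicIndependent hB h
    ((1 : Matrix (Fin n) (Fin n) ℚ).submatrix id φ)
  rw [gramMinor_one_submatrix_of_eq (x := extendAssignment q x true) (i := i) (j := q) hi
      (by rw [extendAssignment_of_ne hi, hx]) (by simp) (by simp [φ]),
    gramMinor_one_submatrix_of_injOn (x := extendAssignment q y true)
      (hφ _ fun _ => by rw [extendAssignment_of_ne hi, hy]),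
    gramMinor_one_submatrix_of_injOn (x := extendAssignment q x false) (hφ _ (by simp))] at h'
  simp at h'

theorem lEnsemble_pos {n : ℕ} {B : Matrix (Fin n) (Fin n) ℝ}
    (hB : AlgebraicIndependent ℚ (fun ij : Fin n × Fin n => B ij.1 ij.2)) (x : Fin n → Bool) :
    0 < lEnsemble (B.transpose * B) x :=
  div_pos (gramMinor_pos (det_ne_zero_of_algebraicIndependent hB) x)
    (det_transpose_mul_self_add_one_pos B)

theorem condProb_lEnsemble_injective {n : ℕ} {B : Matrix (Fin n) (Fin n) ℝ}
    (hB : AlgebraicIndependent ℚ (fun ij : Fin n × Fin n => B ij.1 ij.2)) (q : Fin n) :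
    Function.Injective
      (fun x : {j : Fin n // j ≠ q} → Bool => condProb (lEnsemble (B.transpose * B)) q x) := by
  intro x y hxy
  have hdet := det_transpose_mul_self_add_one_pos B
  have hG := gramMinor_pos (det_ne_zero_of_algebraicIndependent hB)
  have hne : ∀ u : {j : Fin n // j ≠ q} → Bool,
      gramMinor B (extendAssignment q u true) + gramMinor B (extendAssignment q u false) ≠ 0 :=
    fun u => (add_pos (hG _) (hG _)).ne'
  have hcross : gramMinor B (extendAssignment q x true) *
      gramMinor B (extendAssignment q y false) =
      gramMinor B (extendAssignment q y true) * gramMinor B (extendAssignment q x false) := by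
    simp only [condProb, restProb, lEnsemble_eq_gramMinor_div, ← add_div,
      div_div_div_cancel_right₀ hdet.ne'] at hxy
    rw [div_eq_div_iff (hne x) (hne y)] at hxy
    linear_combination hxy
  by_contra hxy'
  obtain ⟨i, hi⟩ := Function.ne_iff.1 hxy'
  cases hx : x i <;> cases hy : y i
  · exact hi (hx.trans hy.symm)
  · exact gramMinor_extendAssignment_mul_ne hB hy hx hcross.symm
  · exact gramMinor_extendAssignment_mul_ne hB hx hy hcross
  · exact hi (hx.trans hy.symm)

/-! ### Evaluation of a PSDD along the right spine of its vtree -/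

/-- The variable at the last leaf from left to right. -/
def VTree.rightmost {n : ℕ} : VTree n → Fin n
  | .leaf x => x
  | .node _ r => r.rightmost

theorem VTree.rightmost_mem_vars {n : ℕ} (v : VTree n) : v.rightmost ∈ v.vars := by
  induction v with
  | leaf x => simp [VTree.rightmost, VTree.vars]
  | node l r _ ihr => simp [VTree.rightmost, VTree.vars, ihr]

namespace PSDDNode

theorem models_of_eval_ne_zero {n : ℕ} {ι : Type} {nd : ι → PSDDNode n ι} {v : VTree n} {i : ι}
    {a : Fin n → Bool} (h : eval nd v i a ≠ 0) : Models nd v i a := by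
  induction v generalizing i with
  | leaf x =>
    unfold eval at h
    unfold Models
    cases hi : nd i <;> simp_all
  | node l r ihl ihr =>
    unfold eval at h
    unfold Models
    cases hi : nd i with
    | decision k p s θ =>
      simp only [hi] at h ⊢
      obtain ⟨j, -, hj⟩ := Finset.exists_ne_zero_of_sum_ne_zero h
      exact ⟨j, ihl (left_ne_zero_of_mul (right_ne_zero_of_mul hj)),
        ihr (right_ne_zero_of_mul (right_ne_zero_of_mul hj))⟩
    | _ => simp [hi] at h

theorem eval_congr {n : ℕ} {ι : Type} {nd : ι → PSDDNode n ι} {v : VTree n} {i : ι}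
    (hi : IsNormalizedFor nd v i) {a a' : Fin n → Bool} (h : ∀ x ∈ v.vars, a x = a' x) :
    eval nd v i a = eval nd v i a' := by
  induction v generalizing i with
  | leaf x =>
    have hx := h x (by simp [VTree.vars])
    unfold IsNormalizedFor at hi
    unfold eval
    cases hn : nd i <;> simp_all
  | node l r ihl ihr =>
    unfold IsNormalizedFor at hi
    unfold eval
    cases hn : nd i with
    | decision k p s θ =>
      simp only [hn] at hi ⊢
      refine Finset.sum_congr rfl fun j _ => ?_
      rw [ihl (hi.1 j) fun x hx => h x (by simp [VTree.vars, hx]),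
        ihr (hi.2.1 j) fun x hx => h x (by simp [VTree.vars, hx])]
    | _ => rfl

/-- Since the primes of a decision node are mutually exclusive, the evaluation is given by any
element whose prime does not vanish. -/
theorem eval_decision_eq {n : ℕ} {ι : Type} {nd : ι → PSDDNode n ι} {l r : VTree n} {i : ι}
    {k : ℕ} {p s : Fin k → ι} {θ : Fin k → ℝ} (hn : nd i = .decision k p s θ)
    (hi : IsNormalizedFor nd (.node l r) i) {a : Fin n → Bool} {j : Fin k}
    (hj : eval nd l (p j) a ≠ 0) :
    eval nd (.node l r) i a = θ j * eval nd l (p j) a * eval nd r (s j) a := by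
  rw [eval, hn]
  simp only
  rw [Finset.sum_eq_single j, mul_assoc]
  · intro j' _ hne
    by_contra h
    unfold IsNormalizedFor at hi
    simp only [hn] at hi
    exact hne ((hi.2.2.2.1 a).unique
      (models_of_eval_ne_zero (left_ne_zero_of_mul (right_ne_zero_of_mul h)))
      (models_of_eval_ne_zero hj))
  · simp

/-- If `a₁` and `a₀` differ only in the rightmost variable of the vtree and the node `i` vanishes
on neither, then the ratio of its values is `θ : (1 - θ)` for some `⊤` node with parameter `θ`. -/
theorem exists_top_of_eval_ne_zero {n : ℕ} {ι : Type} {nd : ι → PSDDNode n ι} {v : VTree n}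
    (hv : v.vars.Nodup) {i : ι} (hi : IsNormalizedFor nd v i) {a₁ a₀ : Fin n → Bool}
    (ha : ∀ x, x ≠ v.rightmost → a₁ x = a₀ x)
    (ha₁ : a₁ v.rightmost = true) (ha₀ : a₀ v.rightmost = false)
    (h₁ : eval nd v i a₁ ≠ 0) (h₀ : eval nd v i a₀ ≠ 0) :
    ∃ (t : ι) (y : Fin n) (θ c : ℝ), nd t = .top y θ ∧
      eval nd v i a₁ = c * θ ∧ eval nd v i a₀ = c * (1 - θ) := by
  induction v generalizing i with
  | leaf x =>
    unfold IsNormalizedFor at hi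
    unfold eval at h₁ h₀ ⊢
    simp only [VTree.rightmost] at ha₁ ha₀
    cases hn : nd i with
    | top y θ =>
      simp only [hn] at hi ⊢
      obtain ⟨rfl, -, -⟩ := hi
      exact ⟨i, y, θ, 1, hn, by simp [ha₁], by simp [ha₀]⟩
    -- A literal vanishes for one of the two values of its variable.
    | lit y b => cases b <;> simp_all
    | bot => simp [hn] at h₁
    | decision k p s θ => simp [hn] at hi
  | node l r _ ihr =>
    simp only [VTree.rightmost] at ha ha₁ ha₀
    simp only [VTree.vars, List.nodup_append] at hv
    cases hn : nd i with
    | decision k p s θ =>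
      have hi' := hi
      unfold IsNormalizedFor at hi'
      simp only [hn] at hi'
      obtain ⟨j, hj⟩ : ∃ j, eval nd l (p j) a₁ ≠ 0 := by
        unfold eval at h₁
        simp only [hn] at h₁
        obtain ⟨j, -, hj⟩ := Finset.exists_ne_zero_of_sum_ne_zero h₁
        exact ⟨j, left_ne_zero_of_mul (right_ne_zero_of_mul hj)⟩
      have hl : eval nd l (p j) a₁ = eval nd l (p j) a₀ :=
        eval_congr (hi'.1 j) fun x hx => ha x (hv.2.2 x hx _ r.rightmost_mem_vars)
      have e₁ := eval_decision_eq hn hi hj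
      have e₀ := eval_decision_eq hn hi (hl ▸ hj)
      rw [← hl] at e₀
      rw [e₁] at h₁ ⊢
      rw [e₀] at h₀ ⊢
      obtain ⟨t, y, η, c, ht, hc₁, hc₀⟩ := ihr hv.2.1 (hi'.2.1 j) ha ha₁ ha₀
        (right_ne_zero_of_mul h₁) (right_ne_zero_of_mul h₀)
      exact ⟨t, y, η, θ j * eval nd l (p j) a₁ * c, ht, by rw [hc₁]; ring, by rw [hc₀]; ring⟩
    | _ => simp [eval, hn] at h₁

end PSDDNode

/-- A PSDD for a positive distribution has at least as many nodes as its rightmost variable has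
distinct conditional probabilities; this is the case where all of them are distinct. -/
theorem PSDD.two_pow_le_size {n : ℕ} (P : PSDD n) {p : (Fin n → Bool) → ℝ} (hP : P.Computes p)
    (hpos : ∀ a, 0 < p a) (hinj : ∀ q : Fin n, Function.Injective (condProb p q)) :
    2 ^ (n - 1) ≤ P.size := by
  obtain ⟨c, -, hc⟩ := hP
  have hne : ∀ a, P.eval a ≠ 0 := fun a h => (hpos a).ne' (by rw [hc, h, mul_zero])
  have key : ∀ x : {j : Fin n // j ≠ P.vtree.rightmost} → Bool, ∃ t y,
      P.nodes t = .top y (condProb p P.vtree.rightmost x) := by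
    intro x
    obtain ⟨t, y, θ, d, ht, h₁, h₀⟩ := PSDDNode.exists_top_of_eval_ne_zero P.nodup_vars
      P.normalized (a₁ := extendAssignment P.vtree.rightmost x true)
      (a₀ := extendAssignment P.vtree.rightmost x false)
      (fun j hj => by simp only [extendAssignment_of_ne hj]) (by simp) (by simp) (hne _) (hne _)
    refine ⟨t, y, ?_⟩
    have e₁ : p (extendAssignment P.vtree.rightmost x true) = c * d * θ := by
      rw [hc, PSDD.eval, h₁, mul_assoc]
    have e₀ : p (extendAssignment P.vtree.rightmost x false) = c * d * (1 - θ) := by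
      rw [hc, PSDD.eval, h₀, mul_assoc]
    have hcd : c * d ≠ 0 :=
      left_ne_zero_of_mul (e₁ ▸ (hpos (extendAssignment P.vtree.rightmost x true)).ne')
    rw [ht, condProb, restProb, e₁, e₀, ← mul_add, add_sub_cancel, mul_one,
      mul_div_cancel_left₀ _ hcd]
  choose t y ht using key
  have ht_inj : Function.Injective t := by
    intro x x' h
    have := ht x
    rw [h, ht x', PSDDNode.top.injEq] at this
    exact hinj _ this.2.symm
  simpa [Fintype.card_subtype_compl] using Fintype.card_le_of_injective t ht_inj

theorem lemma2 (n : ℕ) (hn : 0 < n) (B : Matrix (Fin n) (Fin n) ℝ)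
    (hB : AlgebraicIndependent ℚ (fun ij : Fin n × Fin n => B ij.1 ij.2)) :
    (∀ P : PSDD n, P.Computes (lEnsemble (B.transpose * B)) → 2 ^ (n - 1) ≤ P.size) ∧
    (∀ q : Fin n,
      (∀ x : {j : Fin n // j ≠ q} → Bool, 0 < restProb (lEnsemble (B.transpose * B)) q x) ∧
      Function.Injective
        (fun x : {j : Fin n // j ≠ q} → Bool => condProb (lEnsemble (B.transpose * B)) q x)) := by
  refine ⟨fun P hP => P.two_pow_le_size hP (lEnsemble_pos hB) (condProb_lEnsemble_injective hB),
    fun q => ⟨fun x => add_pos (lEnsemble_pos hB _) (lEnsemble_pos hB _),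
      condProb_lEnsemble_injective hB q⟩⟩
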